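/- Let $X$ be the set of binary strings or the set of natural numbers (or, more generally, any set with a standard effective coding of its elements by natural numbers). A semimeasure on $X$ is a function $a\colon X\to[0,\infty)$ with $\sum_{x\in X}a(x)\le 1$. A real-valued function $a$ is lower semicomputable if there is a computable total rational-valued function $(y,k)\mapsto a(y,k)$ such that, for every argument $y$, the sequence $a(y,0),a(y,1),\dots$ is non-decreasing with limit $a(y)$; it is $\mathbf 0'$-lower semicomputable if $(y,k)\mapsto a(y,k)$ is only required to be computable with oracle $\mathbf 0'$ (the universal enumerable set). A $\mathbf 0'$-relativized a priori probability $m^{\mathbf 0'}$ on $X$ is a $\mathbf 0'$-lower semicomputable semimeasure on $X$ that is maximal up to a constant factor: for every $\mathbf 0'$-lower semicomputable semimeasure $a$ on $X$ there is $c>0$ such that $a(x)\le c\,m^{\mathbf 0'}(x)$ for all $x\in X$. A conditional a priori probability $m(\cdot|\cdot)$ is a function of $(x,n)\in X\times\mathbb N$ that is lower semicomputable (without oracle) as a function of the pair, is a semimeasure in $x$ for every $n$, and is maximal among such functions up to a constant factor independent of $x$ and $n$. Theorem. Conditional a priori probabilities $m(x|n)$ and $\mathbf 0'$-relativized a priori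 probabilities $m^{\mathbf 0'}(x)$ on $X$ exist, and for any choice of them $$\liminf_{n\to\infty} m(x|n)=m^{\mathbf 0'}(x)\quad\text{up to a }\Theta(1)\text{ factor},$$ that is, there are constants $c,C>0$ such that for all $x\in X$ $$c\,m^{\mathbf 0'}(x)\;\le\;\liminf_{n\to\infty} m(x|n)\;\le\; C\,m^{\mathbf 0'}(x).$$ -/

import Mathlib

noncomputable section

namespace APriori

open Filter Topology

open Classical in
/-- The oracle `0'`: the characteristic function of the universal enumerable set, that is, of the
set of (codes of) pairs `(e, k)` such that the `e`-th partial computable function is defined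
at `k`. -/
def zeroJump : ℕ →. ℕ :=
  fun p => Part.some
    (if ((Nat.Partrec.Code.ofNatCode p.unpair.1).eval p.unpair.2).Dom then 1 else 0)

/-- A rational-valued total function is computable relative to the oracles in `O` if it can be
written as `(p - r) / q` with `p`, `r`, `q` natural-number valued and computable relative to `O`
and `q` nowhere zero. -/
def RatComputableIn {β : Type*} [Primcodable β] (O : Set (ℕ →. ℕ)) (f : β → ℚ) : Prop :=
  ∃ p r q : β → ℕ, ComputableIn O p ∧ ComputableIn O r ∧ ComputableIn O q ∧
    ∀ b, q b ≠ 0 ∧ f b = ((p b : ℚ) - (r b : ℚ)) / (q b : ℚ)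

/-- `a` is lower semicomputable relative to `O`: it is the pointwise limit of a non-decreasing
sequence of rational-valued functions, computable relative to `O` as a function of the argument and
the index. For `O = ∅` this is lower semicomputability without any oracle. -/
def LowerSemicomputableIn {β : Type*} [Primcodable β] (O : Set (ℕ →. ℕ)) (a : β → ℝ) : Prop :=
  ∃ f : β × ℕ → ℚ, RatComputableIn O f ∧
    ∀ b, Monotone (fun k => f (b, k)) ∧ Tendsto (fun k => (f (b, k) : ℝ)) atTop (𝓝 (a b))

/-- A semimeasure: a non-negative function with sum at most `1`. -/
def IsSemimeasure {α : Type*} (a : α → ℝ) : Prop :=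
  (∀ x, 0 ≤ a x) ∧ Summable a ∧ ∑' x, a x ≤ 1

/-- `m` is an a priori probability relative to `O`: a lower semicomputable (relative to `O`)
semimeasure that is maximal up to a constant factor. -/
def IsAPrioriIn {α : Type*} [Primcodable α] (O : Set (ℕ →. ℕ)) (m : α → ℝ) : Prop :=
  (IsSemimeasure m ∧ LowerSemicomputableIn O m) ∧
    ∀ a : α → ℝ, IsSemimeasure a → LowerSemicomputableIn O a →
      ∃ c : ℝ, 0 < c ∧ ∀ x, a x ≤ c * m x

/-- A conditional lower semicomputable semimeasure `(x, n) ↦ a(x|n)`: a semimeasure in `x` for every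
condition `n`, lower semicomputable as a function of the pair `(x, n)`. -/
def IsCondLSCSemimeasure {α : Type*} [Primcodable α] (a : α → ℕ → ℝ) : Prop :=
  (∀ n, IsSemimeasure fun x => a x n) ∧ LowerSemicomputableIn ∅ fun p : α × ℕ => a p.1 p.2

/-- `m` is a conditional a priori probability `(x, n) ↦ m(x|n)`: a conditional lower semicomputable
semimeasure that is maximal up to a constant factor (not depending on `x` and `n`). -/
def IsCondAPriori {α : Type*} [Primcodable α] (m : α → ℕ → ℝ) : Prop :=
  IsCondLSCSemimeasure m ∧
    ∀ a : α → ℕ → ℝ, IsCondLSCSemimeasure a → ∃ c : ℝ, 0 < c ∧ ∀ x n, a x n ≤ c * m x n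

end APriori

end

/-! Lower bound: let `a` be a `0'`-lower semicomputable semimeasure with dyadic approximations `d
(x, k) / 2 ^ k`. By the limit lemma (`limitApproximable_of_recursiveIn`) `d` is a pointwise limit of
primitive recursive guesses. The guesses made at time `n` define `b(x|n)`, after `trim` has cut them
so that the total mass is at most 1 whatever they are. For fixed `K` the guesses with indices up to
`K` are correct for all large `n`, and guesses below a semimeasure are never cut (`le_trim`), so
eventually `b(x|n) ≥ d (x, K) / 2 ^ K`. Hence `a ≤ liminf b`, and maximality of `m` finishes.

Upper bound: a rational `q < liminf m(x|n)` is witnessed by a true claim "`m(x|n) ≥ q` for all `n ≥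
N`". Truth of claims is a `Π₂` matter, which `0'` need not decide, so it is replaced by consistency:
raising `m` to satisfy finitely many claims must keep every total mass at most 1. This is `Π₁`,
hence decidable by `0'`. Claims are accepted greedily as long as they stay consistent. True claims
always pass (`Consistent.cons`), and the supremum of the accepted bounds is a `0'`-lower
semicomputable semimeasure.

Existence: trimming the output of every program and mixing with weights `2 ^ -(e + 1)` gives a
conditional a priori probability; the upper bound applied to it gives an a priori probability
relative to `0'`. -/

open Filter Topology Encodable

/-! ### Closure properties of computability -/

namespace ComputableIn

variable {α β γ σ : Type*} [Primcodable α] [Primcodable β] [Primcodable γ] [Primcodable σ]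
  {O : Set (ℕ →. ℕ)}

theorem comp {f : β → σ} {g : α → β} (hf : ComputableIn O f) (hg : ComputableIn O g) :
    ComputableIn O fun a => f (g a) :=
  Nat.RecursiveIn.of_eq (Nat.RecursiveIn.comp hf hg) fun n => by
    rcases e : decode (α := α) n with - | a <;> simp [encodek]

theorem pair {f : α → β} {g : α → γ} (hf : ComputableIn O f) (hg : ComputableIn O g) :
    ComputableIn O fun a => (f a, g a) :=
  Nat.RecursiveIn.of_eq (Nat.RecursiveIn.pair hf hg) fun n => by
    rcases e : decode (α := α) n with - | a <;> simp [Seq.seq]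

theorem of_eq {f g : α → σ} (hf : ComputableIn O f) (H : ∀ a, f a = g a) : ComputableIn O g :=
  (funext H : f = g) ▸ hf

theorem empty_iff {f : α → σ} : ComputableIn ∅ f ↔ Computable f :=
  recursiveIn_empty_iff

/-- Recursion along `ℕ` whose step is computable relative to `O`. -/
theorem nat_rec_nat {f : ℕ → ℕ → ℕ} (a : ℕ) (hf : ComputableIn₂ O f) :
    ComputableIn O fun t : ℕ => (Nat.rec a f t : ℕ) := by
  have h1 : Nat.RecursiveIn O (fun p : ℕ => (Part.some (f p.unpair.1 p.unpair.2) : Part ℕ)) := by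
    refine Nat.RecursiveIn.of_eq hf fun n => ?_
    simp
  have h2 : Nat.RecursiveIn O (fun p : ℕ => (Part.some (f p.unpair.2.unpair.1 p.unpair.2.unpair.2))) :=
    Nat.RecursiveIn.of_eq (Nat.RecursiveIn.comp h1 Nat.RecursiveIn.right) fun n => by simp
  have h3 : Nat.RecursiveIn O (fun _ : ℕ => (Part.some a : Part ℕ)) :=
    Nat.Partrec.recursiveIn (Nat.Partrec.of_primrec (Nat.Primrec.const a))
  -- The scheme `prec` carries a parameter; here it is the dummy value 0.
  have h4 : Nat.RecursiveIn O (fun n : ℕ => (Part.some (Nat.pair 0 n) : Part ℕ)) :=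
    Nat.Partrec.recursiveIn (Nat.Partrec.of_primrec
      (Nat.Primrec.pair Nat.Primrec.zero Nat.Primrec.id))
  have h5 := Nat.RecursiveIn.comp (Nat.RecursiveIn.prec h3 h2) h4
  refine RecursiveIn.iff_nat.2 (Nat.RecursiveIn.of_eq h5 fun n => ?_)
  simp only [Part.bind_eq_bind, Part.bind_some, Nat.unpair_pair]
  induction n with
  | zero => rfl
  | succ n ih => simp [ih]

end ComputableIn

theorem Primrec.nat_pow : Primrec₂ ((· ^ ·) : ℕ → ℕ → ℕ) :=
  Primrec₂.unpaired'.1 Nat.Primrec.pow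

/-- Finite sums of a primitive recursive family are primitive recursive. -/
theorem Primrec.sum_range {α : Type*} [Primcodable α] {f : α → ℕ} {g : α → ℕ → ℕ}
    (hf : Primrec f) (hg : Primrec₂ g) :
    Primrec fun a => ∑ i ∈ Finset.range (f a), g a i := by
  refine (Primrec.nat_rec' (h := fun a p => p.2 + g a p.1) hf (Primrec.const 0) ?_).of_eq
    fun a => ?_
  · exact Primrec.nat_add.comp (Primrec.snd.comp Primrec.snd)
      (hg.comp Primrec.fst (Primrec.fst.comp Primrec.snd))
  · induction f a with
    | zero => rfl
    | succ n ih => simp [Finset.sum_range_succ, ← ih]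

/-- Finite sums of a computable family are computable. -/
theorem Computable.sum_range {α : Type*} [Primcodable α] {f : α → ℕ} {g : α → ℕ → ℕ}
    (hf : Computable f) (hg : Computable₂ g) :
    Computable fun a => ∑ i ∈ Finset.range (f a), g a i := by
  refine (Computable.nat_rec (h := fun a p => p.2 + g a p.1) hf (Computable.const 0) ?_).of_eq
    fun a => ?_
  · exact Primrec.nat_add.to_comp.comp (Computable.snd.comp Computable.snd)
      (hg.comp Computable.fst (Computable.fst.comp Computable.snd))
  · induction f a with
    | zero => rfl
    | succ n ih => simp [Finset.sum_range_succ, ← ih]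

/-! ### The limit lemma and the halting oracle -/

namespace APriori

/-- `f` is a limit of primitive recursive approximations wherever it is defined. -/
def LimitApproximable (f : ℕ →. ℕ) : Prop :=
  ∃ G : ℕ → ℕ → Option ℕ, Primrec₂ G ∧ ∀ n, ∀ y ∈ f n, ∀ᶠ s in atTop, G n s = some y

theorem limitApproximable_of_primrec {f : ℕ → ℕ} (hf : Primrec f) :
    LimitApproximable fun n => Part.some (f n) :=
  ⟨fun n _ => some (f n), Primrec.option_some.comp (hf.comp Primrec.fst), fun n y hy => by
    simp only [Part.mem_some_iff] at hy
    simp [hy]⟩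

/-- Halting is replaced by halting within `s` steps, which is monotone in `s` and therefore changes
at most once. -/
theorem limitApproximable_zeroJump : LimitApproximable zeroJump := by
  refine ⟨fun p s => some (if (Nat.Partrec.Code.evaln s (Nat.Partrec.Code.ofNatCode p.unpair.1)
    p.unpair.2).isSome then 1 else 0), ?_, fun p y hy => ?_⟩
  · refine Primrec.option_some.comp (Primrec.ite ?_ (Primrec.const 1) (Primrec.const 0))
    refine Primrec.eq.comp (Primrec.option_isSome.comp ?_) (Primrec.const true)
    refine Nat.Partrec.Code.primrec_evaln.comp (Primrec.pair (Primrec.pair Primrec.snd ?_) ?_)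
    · refine ((Primrec.ofNat Nat.Partrec.Code).comp
        (Primrec.fst.comp (Primrec.unpair.comp Primrec.fst))).of_eq fun a => ?_
      rw [Nat.Partrec.Code.ofNatCode_eq]
    · exact Primrec.snd.comp (Primrec.unpair.comp Primrec.fst)
  · simp only [zeroJump, Part.mem_some_iff] at hy
    subst hy
    split_ifs with h
    · obtain ⟨v, hv⟩ := Part.dom_iff_mem.1 h
      obtain ⟨k, hk⟩ := Nat.Partrec.Code.evaln_complete.1 hv
      filter_upwards [eventually_ge_atTop k] with s hs
      have := Nat.Partrec.Code.evaln_mono hs hk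
      rw [Option.mem_def] at this
      simp [this]
    · refine Eventually.of_forall fun s => ?_
      cases e : Nat.Partrec.Code.evaln s (Nat.Partrec.Code.ofNatCode p.unpair.1) p.unpair.2 with
      | none => simp [e]
      | some v => exact absurd (Part.dom_iff_mem.2 ⟨v, Nat.Partrec.Code.evaln_sound e⟩) h

theorem LimitApproximable.pair {f h : ℕ →. ℕ} (hf : LimitApproximable f)
    (hh : LimitApproximable h) :
    LimitApproximable fun n => (Nat.pair <$> f n <*> h n) := by
  obtain ⟨F, Fp, hF⟩ := hf
  obtain ⟨H, Hp, hH⟩ := hh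
  refine ⟨fun n s => (F n s).bind fun a => (H n s).map fun b => Nat.pair a b, ?_,
    fun n y hy => ?_⟩
  · refine Primrec.option_bind Fp (Primrec.option_map (Hp.comp (Primrec.fst.comp Primrec.fst)
      (Primrec.snd.comp Primrec.fst)) ?_)
    exact Primrec₂.natPair.comp (Primrec.snd.comp Primrec.fst) Primrec.snd
  · simp only [Seq.seq, Part.map_eq_map, Part.mem_bind_iff, Part.mem_map_iff] at hy
    obtain ⟨_, ⟨a, ha, rfl⟩, b, hb, rfl⟩ := hy
    filter_upwards [hF n a ha, hH n b hb] with s h1 h2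
    simp [h1, h2]

theorem LimitApproximable.comp {f h : ℕ →. ℕ} (hf : LimitApproximable f)
    (hh : LimitApproximable h) : LimitApproximable fun n => h n >>= f := by
  obtain ⟨F, Fp, hF⟩ := hf
  obtain ⟨H, Hp, hH⟩ := hh
  refine ⟨fun n s => (H n s).bind fun a => F a s, ?_, fun n y hy => ?_⟩
  · exact Primrec.option_bind Hp (Fp.comp Primrec.snd (Primrec.snd.comp Primrec.fst))
  · obtain ⟨a, ha, hb⟩ := Part.mem_bind_iff.1 hy
    filter_upwards [hH n a ha, hF a y hb] with s h1 h2
    simp [h1, h2]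

theorem LimitApproximable.prec {f h : ℕ →. ℕ} (hf : LimitApproximable f)
    (hh : LimitApproximable h) :
    LimitApproximable fun p => Nat.rec (motive := fun _ => Part ℕ) (f p.unpair.1)
      (fun y IH => IH.bind fun i => h (Nat.pair p.unpair.1 (Nat.pair y i))) p.unpair.2 := by
  obtain ⟨F, Fp, hF⟩ := hf
  obtain ⟨H, Hp, hH⟩ := hh
  refine ⟨fun p s => Nat.rec (F p.unpair.1 s)
    (fun y IH => IH.bind fun i => H (Nat.pair p.unpair.1 (Nat.pair y i)) s) p.unpair.2, ?_, ?_⟩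
  · refine Primrec.nat_rec' (f := fun q : ℕ × ℕ => q.1.unpair.2)
      (g := fun q => F q.1.unpair.1 q.2)
      (h := fun q r => r.2.bind fun i => H (Nat.pair q.1.unpair.1 (Nat.pair r.1 i)) q.2) ?_ ?_ ?_
    · exact Primrec.snd.comp (Primrec.unpair.comp Primrec.fst)
    · exact Fp.comp (Primrec.fst.comp (Primrec.unpair.comp Primrec.fst)) Primrec.snd
    · refine Primrec.option_bind (Primrec.snd.comp Primrec.snd) (Hp.comp ?_ ?_)
      · refine Primrec₂.natPair.comp ?_ (Primrec₂.natPair.comp ?_ Primrec.snd)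
        · exact Primrec.fst.comp (Primrec.unpair.comp
            (Primrec.fst.comp (Primrec.fst.comp Primrec.fst)))
        · exact Primrec.fst.comp (Primrec.snd.comp Primrec.fst)
      · exact Primrec.snd.comp (Primrec.fst.comp Primrec.fst)
  · intro p
    simp only
    induction p.unpair.2 with
    | zero => exact fun y hy => hF _ y hy
    | succ n ih =>
      intro y hy
      obtain ⟨i, hi, hb⟩ := Part.mem_bind_iff.1 hy
      filter_upwards [ih i hi, hH _ y hb] with s h1 h2
      simp [h1, h2]

/-- The search is cut off at `s`. If it succeeds at `y`, only the finitely many values at indices up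
to `y` matter, and they have all stabilised for large `s`. Nothing is required where the search
diverges. -/
theorem LimitApproximable.rfind {f : ℕ →. ℕ} (hf : LimitApproximable f) :
    LimitApproximable fun a => Nat.rfind fun n => (fun m => m = 0) <$> f (Nat.pair a n) := by
  obtain ⟨F, Fp, hF⟩ := hf
  refine ⟨fun a s => some ((List.range s).findIdx fun i => decide (F (Nat.pair a i) s = some 0)), ?_,
    fun a y hy => ?_⟩
  · refine Primrec.option_some.comp (Primrec.list_findIdx
      (Primrec.list_range.comp Primrec.snd) ?_)
    exact (Primrec.eq.comp (Fp.comp (Primrec₂.natPair.comp (Primrec.fst.comp Primrec.fst)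
      Primrec.snd) (Primrec.snd.comp Primrec.fst)) (Primrec.const (some 0))).decide.to₂
  · obtain ⟨h1, h2⟩ := Nat.mem_rfind.1 hy
    have h3 : ∀ᶠ s in atTop, ∀ i ∈ Finset.range y, F (Nat.pair a i) s ≠ some 0 := by
      rw [Finset.eventually_all]
      intro i hi
      obtain ⟨v, hv, hv0⟩ := (Part.mem_map_iff _).1 (h2 (Finset.mem_range.1 hi))
      filter_upwards [hF _ v hv] with s hs
      rw [hs]
      simpa using hv0
    obtain ⟨v, hv, hv0⟩ := (Part.mem_map_iff _).1 h1
    have hv0 : v = 0 := by simpa using hv0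
    subst hv0
    filter_upwards [h3, hF _ _ hv, eventually_gt_atTop y] with s hs1 hs2 hs3
    rw [Option.some_inj]
    rw [List.findIdx_eq (by simpa using hs3)]
    refine ⟨by simp [hs2], fun j hj => ?_⟩
    simpa using hs1 j (Finset.mem_range.2 hj)

/-- One half of the limit lemma: whatever is computable from `0'` is a limit of primitive recursive
approximations. -/
theorem limitApproximable_of_recursiveIn {f : ℕ →. ℕ} (hf : Nat.RecursiveIn {zeroJump} f) :
    LimitApproximable f := by
  induction hf with
  | zero => exact limitApproximable_of_primrec (Primrec.const 0)
  | succ => exact limitApproximable_of_primrec Primrec.succ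
  | left => exact limitApproximable_of_primrec (Primrec.fst.comp Primrec.unpair)
  | right => exact limitApproximable_of_primrec (Primrec.snd.comp Primrec.unpair)
  | oracle g hg => rw [Set.mem_singleton_iff.1 hg]; exact limitApproximable_zeroJump
  | pair _ _ ihf ihh => exact ihf.pair ihh
  | comp _ _ ihf ihh => exact ihf.comp ihh
  | prec _ _ ihf ihh => exact ihf.prec ihh
  | rfind _ ih => exact ih.rfind

theorem exists_limit_of_computableIn {f : ℕ → ℕ} (hf : ComputableIn {zeroJump} f) :
    ∃ G : ℕ → ℕ → ℕ, Primrec₂ G ∧ ∀ n, ∀ᶠ s in atTop, G n s = f n := by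
  obtain ⟨G, hG, h⟩ := limitApproximable_of_recursiveIn (RecursiveIn.iff_nat.1 hf)
  refine ⟨fun n s => (G n s).getD 0, Primrec.option_getD.comp hG (Primrec.const 0), fun n => ?_⟩
  filter_upwards [h n (f n) (Part.mem_some _)] with s hs
  simp [hs]

/-- `0'` decides every enumerable property. -/
theorem computableIn_zeroJump_of_exists {p : ℕ → ℕ → Bool} (hp : Computable₂ p) :
    ∃ χ : ℕ → ℕ, ComputableIn {zeroJump} χ ∧ ∀ n, χ n = 0 ↔ ∀ j, p n j = false := by
  -- The program searching for `j` halts on `n` exactly when the property holds for some `j`, so one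
  -- oracle query decides it.
  have h1 : Partrec fun n => Nat.rfind fun j => Part.some (p n j) :=
    Partrec.rfind hp.partrec₂
  obtain ⟨c, hc⟩ := Nat.Partrec.Code.exists_code.1 (Partrec.nat_iff.1 h1)
  classical
  refine ⟨fun n => if (c.eval n).Dom then 1 else 0, ?_, fun n => ?_⟩
  · have h2 : ComputableIn {zeroJump} (fun q : ℕ =>
        if ((Nat.Partrec.Code.ofNatCode q.unpair.1).eval q.unpair.2).Dom then 1 else 0) :=
      (RecursiveIn.oracle zeroJump (Set.mem_singleton _)).of_eq fun q => by
        unfold zeroJump; congr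
    have h3 : ComputableIn {zeroJump} (fun n : ℕ => Nat.pair (encode c) n) :=
      (Primrec₂.natPair.comp (Primrec.const _) Primrec.id).computableIn
    refine ComputableIn.of_eq (h2.comp h3) fun n => ?_
    rw [Nat.unpair_pair, ← Nat.Partrec.Code.ofNatCode_eq]
    simp
  · have : (c.eval n).Dom ↔ ∃ j, p n j = true := by
      rw [hc]
      refine Nat.rfind_dom'.trans ⟨?_, ?_⟩
      · rintro ⟨j, hj, -⟩
        exact ⟨j, (Part.mem_some_iff.1 hj).symm⟩
      · rintro ⟨j, hj⟩
        exact ⟨j, Part.mem_some_iff.2 hj.symm, fun _ => trivial⟩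
    simp [this]

/-! ### Dyadic approximation and lower semicomputability -/

/-- Approximation from below by dyadic fractions `d (b, k) / 2 ^ k`. -/
structure IsDyadicApprox {β : Type*} (d : β × ℕ → ℕ) (a : β → ℝ) : Prop where
  double_le : ∀ b k, 2 * d (b, k) ≤ d (b, k + 1)
  tendsto : ∀ b, Tendsto (fun k => (d (b, k) : ℝ) / 2 ^ k) atTop (𝓝 (a b))

theorem monotone_div_two_pow {d : ℕ → ℕ} (h : ∀ k, 2 * d k ≤ d (k + 1)) :
    Monotone fun k => (d k : ℝ) / 2 ^ k := by
  refine monotone_nat_of_le_succ fun k => ?_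
  rw [div_le_div_iff₀ (by positivity) (by positivity), pow_succ]
  have : (2 * d k : ℝ) ≤ d (k + 1) := by exact_mod_cast h k
  nlinarith [pow_pos (zero_lt_two (α := ℝ)) k]

theorem IsDyadicApprox.le {β : Type*} {d : β × ℕ → ℕ} {a : β → ℝ} (h : IsDyadicApprox d a) (b : β) (k : ℕ) :
    (d (b, k) : ℝ) ≤ 2 ^ k * a b := by
  rw [mul_comm, ← div_le_iff₀ (by positivity)]
  exact (monotone_div_two_pow (h.double_le b)).ge_of_tendsto (h.tendsto b) k

section LowerSemicomputable

variable {α β : Type*} [Primcodable α] [Primcodable β] {O : Set (ℕ →. ℕ)}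

theorem LowerSemicomputableIn.of_nat_div {a : β → ℝ} {p q : β × ℕ → ℕ} (hp : ComputableIn O p)
    (hq : ComputableIn O q) (hq0 : ∀ b, q b ≠ 0)
    (hmono : ∀ b, Monotone fun k => (p (b, k) : ℝ) / q (b, k))
    (hlim : ∀ b, Tendsto (fun k => (p (b, k) : ℝ) / q (b, k)) atTop (𝓝 (a b))) :
    LowerSemicomputableIn O a := by
  refine ⟨fun b => (p b : ℚ) / q b, ⟨p, fun _ => 0, q, hp, ComputableIn.const 0, hq,
    fun b => ⟨hq0 b, by simp⟩⟩, fun b => ⟨fun i j hij => ?_, ?_⟩⟩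
  · have := hmono b hij
    simp only at this ⊢
    rw [← Rat.cast_le (K := ℝ)]
    push_cast
    exact this
  · simpa using hlim b

theorem IsDyadicApprox.lowerSemicomputableIn {d : β × ℕ → ℕ} {a : β → ℝ}
    (h : IsDyadicApprox d a) (hd : ComputableIn O d) : LowerSemicomputableIn O a :=
  .of_nat_div (q := fun b => 2 ^ b.2) hd
    (Primrec.nat_pow.comp (Primrec.const 2) Primrec.snd).computableIn (fun _ => by positivity)
    (fun b => by simpa using monotone_div_two_pow (h.double_le b))
    (fun b => by simpa using h.tendsto b)

/-- Take `⌊2 ^ k * max (f (b, k)) 0⌋₊`: rounding down costs less than `2 ^ -k`, and `2⌊y⌋ ≤ ⌊2y⌋`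
gives the doubling condition. Truncated subtraction of numerators computes the maximum with 0. -/
theorem LowerSemicomputableIn.exists_dyadicApprox {a : β → ℝ} (h : LowerSemicomputableIn O a)
    (ha : ∀ b, 0 ≤ a b) : ∃ d : β × ℕ → ℕ, ComputableIn O d ∧ IsDyadicApprox d a := by
  obtain ⟨f, ⟨p, r, q, hp, hr, hq, hf⟩, hlim⟩ := h
  have hpr : Primrec fun t : ℕ × ℕ × ℕ × ℕ => 2 ^ t.1 * (t.2.1 - t.2.2.1) / t.2.2.2 :=
    Primrec.nat_div.comp (Primrec.nat_mul.comp
      (Primrec.nat_pow.comp (Primrec.const 2) Primrec.fst)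
      (Primrec.nat_sub.comp (Primrec.fst.comp Primrec.snd)
        (Primrec.fst.comp (Primrec.snd.comp Primrec.snd))))
      (Primrec.snd.comp (Primrec.snd.comp Primrec.snd))
  have hfloor : ∀ b k, 2 ^ k * (p (b, k) - r (b, k)) / q (b, k) =
      ⌊2 ^ k * max (f (b, k)) 0⌋₊ := by
    intro b k
    obtain ⟨hq0, hfe⟩ := hf (b, k)
    have hq0' : (0 : ℚ) < q (b, k) := by exact_mod_cast Nat.pos_of_ne_zero hq0
    have : max (f (b, k)) 0 = ((p (b, k) - r (b, k) : ℕ) : ℚ) / q (b, k) := by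
      rw [hfe]
      rcases le_total (r (b, k)) (p (b, k)) with hle | hle
      · have : (r (b, k) : ℚ) ≤ p (b, k) := by exact_mod_cast hle
        rw [Nat.cast_sub hle, max_eq_left (div_nonneg (sub_nonneg.2 this) hq0'.le)]
      · have : (p (b, k) : ℚ) ≤ r (b, k) := by exact_mod_cast hle
        rw [Nat.sub_eq_zero_of_le hle,
          max_eq_right (div_nonpos_of_nonpos_of_nonneg (sub_nonpos.2 this) hq0'.le)]
        simp
    rw [this, ← mul_div_assoc, ← Nat.floor_div_eq_div (K := ℚ)]
    push_cast
    rfl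
  refine ⟨fun t => 2 ^ t.2 * (p t - r t) / q t,
    hpr.computableIn.comp (ComputableIn.snd.pair (hp.pair (hr.pair hq))), ⟨fun b k => ?_,
    fun b => ?_⟩⟩
  · simp only [hfloor]
    have hm : max (f (b, k)) 0 ≤ max (f (b, k + 1)) 0 :=
      max_le_max ((hlim b).1 k.le_succ) le_rfl
    refine Nat.le_floor ?_
    push_cast
    have := Nat.floor_le (a := 2 ^ k * max (f (b, k)) 0) (by positivity)
    rw [pow_succ]
    have h2 : (0 : ℚ) < 2 ^ k := by positivity
    nlinarith
  · simp only [hfloor]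
    have h1 : Tendsto (fun k => ((max (f (b, k)) 0 : ℚ) : ℝ)) atTop (𝓝 (a b)) := by
      have := ((hlim b).2.max (tendsto_const_nhds (x := (0 : ℝ))))
      rw [max_eq_left (ha b)] at this
      refine this.congr fun k => ?_
      push_cast
      rfl
    have h2 : Tendsto (fun k => ((max (f (b, k)) 0 : ℚ) : ℝ) - (1 / 2 : ℝ) ^ k) atTop
        (𝓝 (a b)) := by
      simpa using h1.sub (tendsto_pow_atTop_nhds_zero_of_lt_one (r := (1 / 2 : ℝ))
        (by norm_num) (by norm_num))
    refine tendsto_of_tendsto_of_tendsto_of_le_of_le h2 h1 (fun k => ?_) (fun k => ?_)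
    · have := Nat.lt_floor_add_one (2 ^ k * max (f (b, k)) 0)
      have : (2 : ℝ) ^ k * ((max (f (b, k)) 0 : ℚ) : ℝ) < ⌊2 ^ k * max (f (b, k)) 0⌋₊ + 1 := by
        exact_mod_cast this
      have h2 : (0 : ℝ) < 2 ^ k := by positivity
      simp only [one_div, inv_pow]
      rw [le_div_iff₀ h2, sub_mul, inv_mul_cancel₀ h2.ne']
      linarith
    · have := Nat.floor_le (a := 2 ^ k * max (f (b, k)) 0) (by positivity)
      have : (⌊2 ^ k * max (f (b, k)) 0⌋₊ : ℝ) ≤ 2 ^ k * ((max (f (b, k)) 0 : ℚ) : ℝ) := by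
        exact_mod_cast this
      simp only
      rwa [div_le_iff₀ (by positivity), mul_comm (Rat.cast _)]

theorem LowerSemicomputableIn.comp {a : β → ℝ} (h : LowerSemicomputableIn O a) {g : α → β}
    (hg : ComputableIn O g) : LowerSemicomputableIn O fun x => a (g x) := by
  obtain ⟨f, ⟨p, r, q, hp, hr, hq, hf⟩, hlim⟩ := h
  have hg' : ComputableIn O fun t : α × ℕ => (g t.1, t.2) :=
    (hg.comp ComputableIn.fst).pair ComputableIn.snd
  exact ⟨fun t => f (g t.1, t.2), ⟨_, _, _, hp.comp hg', hr.comp hg', hq.comp hg',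
    fun t => hf (g t.1, t.2)⟩, fun x => hlim (g x)⟩

/-- Restriction to a primitive recursive set after a computable change of argument. -/
theorem LowerSemicomputableIn.ite_comp {a : β → ℝ} (h : LowerSemicomputableIn O a) {g : α → β}
    (hg : ComputableIn O g) {P : α → Prop} [DecidablePred P] (hP : PrimrecPred P) :
    LowerSemicomputableIn O fun x => if P x then a (g x) else 0 := by
  obtain ⟨f, ⟨p, r, q, hp, hr, hq, hf⟩, hlim⟩ := h.comp hg
  have hite : Primrec fun t : α × ℕ => if P t.1 then t.2 else 0 :=
    Primrec.ite (hP.comp Primrec.fst) Primrec.snd (Primrec.const 0)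
  have hite' : ∀ {p : α × ℕ → ℕ}, ComputableIn O p →
      ComputableIn O fun t : α × ℕ => if P t.1 then p t else 0 := fun hp =>
    hite.computableIn.comp (ComputableIn.fst.pair hp)
  refine ⟨fun t => if P t.1 then f t else 0, ⟨_, _, _, hite' hp, hite' hr, hq,
    fun t => ⟨(hf t).1, ?_⟩⟩, fun x => ?_⟩
  · by_cases ht : P t.1
    · simpa [ht] using (hf t).2
    · simp [ht]
  · by_cases hx : P x
    · simpa [hx] using hlim x
    · simpa [hx] using monotone_const

end LowerSemicomputable

/-! ### Semimeasures -/

theorem isSemimeasure_of_sum_le {α : Type*} {a : α → ℝ} (h0 : ∀ x, 0 ≤ a x)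
    (h : ∀ s : Finset α, ∑ x ∈ s, a x ≤ 1) : IsSemimeasure a :=
  have hs := summable_of_sum_le h0 h
  ⟨h0, hs, hs.tsum_le_of_sum_le h⟩

theorem IsSemimeasure.sum_le {α : Type*} {a : α → ℝ} (h : IsSemimeasure a) (s : Finset α) :
    ∑ x ∈ s, a x ≤ 1 :=
  (h.2.1.sum_le_tsum s fun x _ => h.1 x).trans h.2.2

theorem IsSemimeasure.le_one {α : Type*} {a : α → ℝ} (h : IsSemimeasure a) (x : α) : a x ≤ 1 := by
  simpa using h.sum_le {x}

theorem IsSemimeasure.comp_injective {α β : Type*} {a : β → ℝ} (h : IsSemimeasure a) {g : α → β}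
    (hg : Function.Injective g) : IsSemimeasure fun x => a (g x) :=
  isSemimeasure_of_sum_le (fun x => h.1 _) fun s => by
    classical
    rw [← Finset.sum_image (f := a) (hg.injOn)]
    exact h.sum_le _

theorem IsSemimeasure.extend {α β : Type*} {a : α → ℝ} (h : IsSemimeasure a) {g : α → β}
    (hg : Function.Injective g) : IsSemimeasure (Function.extend g a 0) := by
  refine ⟨fun y => ?_, ?_, ?_⟩
  · by_cases hy : ∃ x, g x = y
    · obtain ⟨x, rfl⟩ := hy
      rw [hg.extend_apply]
      exact h.1 x
    · rw [Function.extend_apply' _ _ _ hy]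
      rfl
  · exact (hg.summable_iff (f := Function.extend g a 0)
      (fun y hy => Function.extend_apply' (f := g) a 0 y hy)).1
      (by rw [Function.extend_comp hg]; exact h.2.1)
  · rw [tsum_extend_zero hg]
    exact h.2.2

/-- Dyadic values that at least double at each step and have bounded total mass converge to a
semimeasure. -/
theorem exists_isSemimeasure_of_double_le {h : ℕ → ℕ → ℕ} (hd : ∀ x k, 2 * h x k ≤ h x (k + 1))
    (hs : ∀ k, ∑ x ∈ Finset.range k, h x k ≤ 2 ^ k) :
    ∃ e : ℕ → ℝ, IsSemimeasure e ∧ IsDyadicApprox (fun p => h p.1 p.2) e := by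
  -- The mass bound at stage `k` covers only arguments below `k`, so it applies to `F` only for
  -- large `k`.
  have hs' : ∀ (F : Finset ℕ), ∀ᶠ k in atTop, ∑ x ∈ F, (h x k : ℝ) / 2 ^ k ≤ 1 := by
    intro F
    obtain ⟨N, hN⟩ := F.exists_nat_subset_range
    filter_upwards [eventually_ge_atTop N] with k hk
    rw [← Finset.sum_div, div_le_one (by positivity)]
    have : ∑ x ∈ F, h x k ≤ 2 ^ k :=
      (Finset.sum_le_sum_of_subset (hN.trans (Finset.range_subset_range.2 hk))).trans (hs k)
    exact_mod_cast this
  have hm := fun x => monotone_div_two_pow (hd x)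
  have hb : ∀ x, BddAbove (Set.range fun k => (h x k : ℝ) / 2 ^ k) := by
    intro x
    obtain ⟨N, hN⟩ := eventually_atTop.1 (hs' {x})
    refine ⟨1, ?_⟩
    rintro _ ⟨k, rfl⟩
    exact (hm x (le_max_left k N)).trans (by simpa using hN _ (le_max_right k N))
  have ht := fun x => tendsto_atTop_ciSup (hm x) (hb x)
  refine ⟨fun x => ⨆ k, (h x k : ℝ) / 2 ^ k, isSemimeasure_of_sum_le (fun x => ?_) (fun F => ?_),
    ⟨hd, ht⟩⟩
  · exact ge_of_tendsto' (ht x) fun k => by positivity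
  · exact le_of_tendsto (tendsto_finsetSum F fun x _ => ht x) (hs' F)

/-! ### Trimming arbitrary proposals to a semimeasure -/

section Trim

/-- The running maximum of a sequence of dyadic fractions `r k x / 2 ^ k`. -/
def runMax (r : ℕ → ℕ → ℕ) (k x : ℕ) : ℕ :=
  Nat.rec (r 0 x) (fun k v => max (2 * v) (r (k + 1) x)) k

theorem runMax_succ (r : ℕ → ℕ → ℕ) (k x : ℕ) :
    runMax r (k + 1) x = max (2 * runMax r k x) (r (k + 1) x) := rfl

theorem le_runMax (r : ℕ → ℕ → ℕ) (k x : ℕ) : r k x ≤ runMax r k x := by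
  cases k with
  | zero => exact le_rfl
  | succ k => exact le_max_right _ _

theorem two_mul_runMax_le (r : ℕ → ℕ → ℕ) (k x : ℕ) : 2 * runMax r k x ≤ runMax r (k + 1) x :=
  le_max_left _ _

theorem runMax_le_of_double_le {r w : ℕ → ℕ → ℕ} {x K : ℕ} (h : ∀ k ≤ K, r k x ≤ w k x)
    (hw : ∀ k, 2 * w k x ≤ w (k + 1) x) : runMax r K x ≤ w K x := by
  induction K with
  | zero => exact h 0 le_rfl
  | succ k ih =>
    exact max_le ((Nat.mul_le_mul_left 2 (ih fun j hj => h j (by omega))).trans (hw k))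
      (h _ le_rfl)

theorem runMax_le {r : ℕ → ℕ → ℕ} {a : ℝ} {x K : ℕ}
    (h : ∀ k ≤ K, (r k x : ℝ) ≤ 2 ^ k * a) : (runMax r K x : ℝ) ≤ 2 ^ K * a := by
  induction K with
  | zero => exact h 0 le_rfl
  | succ k ih =>
    have := ih fun j hj => h j (by omega)
    rw [runMax_succ]
    push_cast
    refine max_le ?_ (h _ le_rfl)
    rw [pow_succ]
    linarith

theorem primrec_runMax {γ : Type*} [Primcodable γ] {r : γ → ℕ → ℕ → ℕ} {k x : γ → ℕ}
    (hr : Primrec fun t : γ × ℕ × ℕ => r t.1 t.2.1 t.2.2) (hk : Primrec k) (hx : Primrec x) :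
    Primrec fun c => runMax (r c) (k c) (x c) := by
  refine Primrec.nat_rec' (h := fun c p => max (2 * p.2) (r c (p.1 + 1) (x c))) hk
    (hr.comp (Primrec.id.pair ((Primrec.const 0).pair hx))) ?_
  refine Primrec.nat_max.comp (Primrec.nat_mul.comp (Primrec.const 2)
    (Primrec.snd.comp Primrec.snd)) (hr.comp (Primrec.fst.pair
      ((Primrec.succ.comp (Primrec.fst.comp Primrec.snd)).pair (hx.comp Primrec.fst))))

/-- The running maximum of proposed values, where only arguments up to `k` are considered
at stage `k`. -/
def proposal (r : ℕ → ℕ → ℕ) : ℕ → ℕ → ℕ :=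
  runMax fun k x => if x ≤ k then r k x else 0

/-- The proposed values, frozen as soon as their total mass exceeds `1`. -/
def trim (r : ℕ → ℕ → ℕ) : ℕ → ℕ → ℕ :=
  runMax fun k x => if ∑ y ∈ Finset.range (k + 1), proposal r k y ≤ 2 ^ k then proposal r k x else 0

/-- Finite support makes the mass test in `trim` a finite sum that sees all of the mass. -/
theorem proposal_eq_zero (r : ℕ → ℕ → ℕ) {k x : ℕ} (h : k < x) : proposal r k x = 0 := by
  induction k with
  | zero => simp [proposal, runMax, h.ne']
  | succ k ih =>
    have := ih (by omega)
    unfold proposal at this ⊢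
    rw [runMax_succ, this, if_neg (by omega)]
    rfl

theorem trim_le_proposal (r : ℕ → ℕ → ℕ) (k x : ℕ) : trim r k x ≤ proposal r k x :=
  runMax_le_of_double_le (fun k _ => by split_ifs <;> simp) fun k => two_mul_runMax_le _ k x

theorem two_mul_trim_le (r : ℕ → ℕ → ℕ) (k x : ℕ) : 2 * trim r k x ≤ trim r (k + 1) x :=
  two_mul_runMax_le _ k x

/-- If the proposals pass the mass test, they dominate the trimmed values. Otherwise the numerators
merely double, so the mass is that of the previous stage. -/
theorem sum_range_trim_le (r : ℕ → ℕ → ℕ) (k : ℕ) :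
    ∑ x ∈ Finset.range (k + 1), trim r k x ≤ 2 ^ k := by
  by_cases hgood : ∑ x ∈ Finset.range (k + 1), proposal r k x ≤ 2 ^ k
  · exact (Finset.sum_le_sum fun x _ => trim_le_proposal r k x).trans hgood
  · induction k with
    | zero =>
      simp only [trim, runMax, if_neg hgood]
      simp
    | succ k ih =>
      have h1 : ∀ x, trim r (k + 1) x = 2 * trim r k x := fun x => by
        rw [trim, runMax_succ, if_neg hgood]
        simp
      have h2 : trim r k (k + 1) = 0 :=
        Nat.le_zero.1 ((trim_le_proposal r k _).trans (proposal_eq_zero r k.lt_succ_self).le)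
      simp only [h1, Finset.sum_range_succ _ (k + 1), h2, ← Finset.mul_sum]
      have h3 : ∑ x ∈ Finset.range (k + 1), trim r k x ≤ 2 ^ k := by
        by_cases hg : ∑ x ∈ Finset.range (k + 1), proposal r k x ≤ 2 ^ k
        · exact (Finset.sum_le_sum fun x _ => trim_le_proposal r k x).trans hg
        · exact ih hg
      rw [pow_succ]
      omega

theorem sum_trim_le (r : ℕ → ℕ → ℕ) (k : ℕ) (s : Finset ℕ) : ∑ x ∈ s, trim r k x ≤ 2 ^ k := by
  refine le_trans ?_ (sum_range_trim_le r k)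
  refine Finset.sum_le_sum_of_ne_zero fun x _ hx => ?_
  by_contra hxk
  refine hx (Nat.le_zero.1 ((trim_le_proposal r k x).trans (proposal_eq_zero r ?_).le))
  simpa using hxk

/-- Proposals below a semimeasure are never rejected. -/
theorem le_trim {r : ℕ → ℕ → ℕ} {a : ℕ → ℝ} (ha : IsSemimeasure a) {K : ℕ}
    (h : ∀ k ≤ K, ∀ x ≤ K, (r k x : ℝ) ≤ 2 ^ k * a x) {x : ℕ} (hx : x ≤ K) :
    r K x ≤ trim r K x := by
  have h1 : ∀ x ≤ K, (proposal r K x : ℝ) ≤ 2 ^ K * a x := fun x hx =>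
    runMax_le fun k hk => by
      split_ifs
      · exact h k hk x hx
      · simpa using ha.1 x
  have h2 : ∑ y ∈ Finset.range (K + 1), proposal r K y ≤ 2 ^ K := by
    have : (∑ y ∈ Finset.range (K + 1), (proposal r K y : ℝ)) ≤ 2 ^ K := by
      calc _ ≤ ∑ y ∈ Finset.range (K + 1), 2 ^ K * a y :=
            Finset.sum_le_sum fun y hy => h1 y (Nat.lt_succ_iff.1 (Finset.mem_range.1 hy))
        _ = 2 ^ K * ∑ y ∈ Finset.range (K + 1), a y := by rw [Finset.mul_sum]
        _ ≤ 2 ^ K * 1 := by gcongr; exact ha.sum_le _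
        _ = 2 ^ K := mul_one _
    exact_mod_cast this
  calc r K x = (if x ≤ K then r K x else 0) := by rw [if_pos hx]
    _ ≤ proposal r K x := le_runMax (fun k x => if x ≤ k then r k x else 0) K x
    _ = (if ∑ y ∈ Finset.range (K + 1), proposal r K y ≤ 2 ^ K then proposal r K x else 0) := by
        rw [if_pos h2]
    _ ≤ trim r K x := le_runMax (fun k x => if ∑ y ∈ Finset.range (k + 1), proposal r k y ≤ 2 ^ k
        then proposal r k x else 0) K x

theorem primrec_proposal {γ : Type*} [Primcodable γ] {r : γ → ℕ → ℕ → ℕ} {k x : γ → ℕ}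
    (hr : Primrec fun t : γ × ℕ × ℕ => r t.1 t.2.1 t.2.2) (hk : Primrec k) (hx : Primrec x) :
    Primrec fun c => proposal (r c) (k c) (x c) :=
  primrec_runMax (r := fun c k x => if x ≤ k then r c k x else 0)
    (Primrec.ite (Primrec.nat_le.comp (Primrec.snd.comp Primrec.snd)
      (Primrec.fst.comp Primrec.snd)) hr (Primrec.const 0)) hk hx

theorem primrec_trim {γ : Type*} [Primcodable γ] {r : γ → ℕ → ℕ → ℕ} {k x : γ → ℕ}
    (hr : Primrec fun t : γ × ℕ × ℕ => r t.1 t.2.1 t.2.2) (hk : Primrec k) (hx : Primrec x) :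
    Primrec fun c => trim (r c) (k c) (x c) := by
  have hk' : Primrec fun t : γ × ℕ × ℕ => t.2.1 := Primrec.fst.comp Primrec.snd
  refine primrec_runMax (r := fun c k x => if ∑ y ∈ Finset.range (k + 1),
    proposal (r c) k y ≤ 2 ^ k then proposal (r c) k x else 0)
    (Primrec.ite (Primrec.nat_le.comp (Primrec.sum_range (Primrec.succ.comp hk') ?_)
      (Primrec.nat_pow.comp (Primrec.const 2) hk')) ?_ (Primrec.const 0)) hk hx
  · exact primrec_proposal (γ := (γ × ℕ × ℕ) × ℕ) (r := fun t => r t.1.1)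
      (hr.comp ((Primrec.fst.comp (Primrec.fst.comp Primrec.fst)).pair Primrec.snd))
      (hk'.comp Primrec.fst) Primrec.snd
  · exact primrec_proposal (r := fun t : γ × ℕ × ℕ => r t.1)
      (hr.comp ((Primrec.fst.comp Primrec.fst).pair Primrec.snd)) hk'
      (Primrec.snd.comp Primrec.snd)

end Trim

/-! ### Lower bound for the lower limit -/

/-- Every `0'`-lower semicomputable semimeasure is a lower bound of the lower limit of a conditional
lower semicomputable semimeasure. -/
theorem exists_le_liminf_nat {a : ℕ → ℝ} (ha : IsSemimeasure a)
    (hlsc : LowerSemicomputableIn {zeroJump} a) :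
    ∃ b : ℕ → ℕ → ℝ, IsCondLSCSemimeasure b ∧ ∀ x, a x ≤ liminf (fun n => b x n) atTop := by
  obtain ⟨d, hd, hda⟩ := hlsc.exists_dyadicApprox ha.1
  have hd' : ComputableIn {zeroJump} fun t : ℕ => d t.unpair := hd.comp ComputableIn.unpair
  obtain ⟨G, hG, hGd⟩ := exists_limit_of_computableIn hd'
  -- The guess at time `n` for `d (x, k)`.
  let r : ℕ → ℕ → ℕ → ℕ := fun n k x => G (Nat.pair x k) n
  have hr : Primrec fun t : ℕ × ℕ × ℕ => r t.1 t.2.1 t.2.2 :=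
    hG.comp (Primrec₂.natPair.comp (Primrec.snd.comp Primrec.snd) (Primrec.fst.comp Primrec.snd))
      Primrec.fst
  have hb1 : ∀ x n, (trim (r n) n x : ℝ) / 2 ^ n ≤ 1 := fun x n => by
    rw [div_le_one (by positivity)]
    have := sum_trim_le (r n) n {x}
    rw [Finset.sum_singleton] at this
    exact_mod_cast this
  refine ⟨fun x n => (trim (r n) n x : ℝ) / 2 ^ n, ⟨fun n => ?_, ?_⟩, fun x => ?_⟩
  · refine isSemimeasure_of_sum_le (fun x => by positivity) fun s => ?_
    rw [← Finset.sum_div, div_le_one (by positivity)]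
    exact_mod_cast sum_trim_le (r n) n s
  · refine LowerSemicomputableIn.of_nat_div (p := fun t => trim (r t.1.2) t.1.2 t.1.1)
      (q := fun t => 2 ^ t.1.2) ?_ ?_ (fun _ => by positivity) (fun t => ?_) (fun t => ?_)
    · have ht : Primrec fun t : (ℕ × ℕ) × ℕ => t.1.2 := Primrec.snd.comp Primrec.fst
      exact (primrec_trim (γ := (ℕ × ℕ) × ℕ) (r := fun t => r t.1.2)
        (hr.comp ((ht.comp Primrec.fst).pair Primrec.snd)) ht
        (Primrec.fst.comp Primrec.fst)).computableIn
    · exact (Primrec.nat_pow.comp (Primrec.const 2) (Primrec.snd.comp Primrec.fst)).computableIn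
    -- The values of `b` are themselves computable, so the approximating sequence is constant.
    · exact fun _ _ _ => le_rfl
    · simp
  · refine le_of_tendsto (hda.tendsto x) ?_
    -- `K` stays fixed while `n` tends to infinity; beyond `K` the guesses may be wrong, but trimmed
    -- fractions never decrease.
    filter_upwards [eventually_ge_atTop x] with K hK
    have hev : ∀ᶠ n in atTop, ∀ k ∈ Finset.range (K + 1), ∀ y ∈ Finset.range (K + 1),
        r n k y = d (y, k) := by
      simp only [Finset.eventually_all]
      intro k _ y _
      filter_upwards [hGd (Nat.pair y k)] with n hn
      simpa using hn
    refine le_liminf_of_le (isCoboundedUnder_ge_of_le atTop (x := 1) fun n => hb1 x n) ?_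
    filter_upwards [hev, eventually_ge_atTop K] with n hn hKn
    have h1 : r n K x ≤ trim (r n) K x := by
      refine le_trim ha (fun k hk y hy => ?_) hK
      rw [hn k (Finset.mem_range.2 (by omega)) y (Finset.mem_range.2 (by omega))]
      exact hda.le y k
    rw [hn K (by simp) x (Finset.mem_range.2 (by omega))] at h1
    calc (d (x, K) : ℝ) / 2 ^ K ≤ (trim (r n) K x : ℝ) / 2 ^ K := by gcongr
      _ ≤ _ := monotone_div_two_pow (fun k => two_mul_trim_le (r n) k x) hKn

/-! ### The universal conditional mixture -/

section Universal

/-- The value proposed at stage `k` by the program `e` for the argument `x` under the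
condition `n`. -/
def codeProposal (e n k x : ℕ) : ℕ :=
  2 ^ (k - k.unpair.1) * (Nat.Partrec.Code.evaln k (Denumerable.ofNat Nat.Partrec.Code e)
    (Nat.pair (Nat.pair x n) k.unpair.1)).getD 0

theorem primrec_codeProposal :
    Primrec fun t : (ℕ × ℕ) × ℕ × ℕ => codeProposal t.1.1 t.1.2 t.2.1 t.2.2 := by
  have hk : Primrec fun t : (ℕ × ℕ) × ℕ × ℕ => t.2.1 := Primrec.fst.comp Primrec.snd
  have hj : Primrec fun t : (ℕ × ℕ) × ℕ × ℕ => t.2.1.unpair.1 :=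
    Primrec.fst.comp (Primrec.unpair.comp hk)
  have hc : Primrec fun t : (ℕ × ℕ) × ℕ × ℕ => Denumerable.ofNat Nat.Partrec.Code t.1.1 :=
    (Primrec.ofNat _).comp (Primrec.fst.comp Primrec.fst)
  have harg : Primrec fun t : (ℕ × ℕ) × ℕ × ℕ =>
      Nat.pair (Nat.pair t.2.2 t.1.2) t.2.1.unpair.1 :=
    Primrec₂.natPair.comp (Primrec₂.natPair.comp (Primrec.snd.comp Primrec.snd)
      (Primrec.snd.comp Primrec.fst)) hj
  exact Primrec.nat_mul.comp (Primrec.nat_pow.comp (Primrec.const 2) (Primrec.nat_sub.comp hk hj))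
    (Primrec.option_getD.comp (Nat.Partrec.Code.primrec_evaln.comp
      ((hk.pair hc).pair harg)) (Primrec.const 0))

/-- The numerator over `4 ^ k` of the stage `k` approximation to the universal mixture. -/
def mixture (x n k : ℕ) : ℕ :=
  ∑ e ∈ Finset.range k, 2 ^ (k - (e + 1)) * trim (codeProposal e n) k x

theorem primrec_mixture : Primrec fun t : (ℕ × ℕ) × ℕ => mixture t.1.1 t.1.2 t.2 := by
  have he : Primrec fun t : ((ℕ × ℕ) × ℕ) × ℕ => t.2 := Primrec.snd
  have hk : Primrec fun t : ((ℕ × ℕ) × ℕ) × ℕ => t.1.2 := Primrec.snd.comp Primrec.fst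
  refine Primrec.sum_range Primrec.snd (Primrec.nat_mul.comp (Primrec.nat_pow.comp
    (Primrec.const 2) (Primrec.nat_sub.comp hk (Primrec.succ.comp he))) ?_)
  refine primrec_trim (γ := ((ℕ × ℕ) × ℕ) × ℕ) (r := fun t => codeProposal t.2 t.1.1.2)
    (primrec_codeProposal.comp (Primrec.pair (Primrec.pair ?_ ?_) Primrec.snd)) hk ?_
  · exact he.comp Primrec.fst
  · exact Primrec.snd.comp (Primrec.fst.comp (Primrec.fst.comp Primrec.fst))
  · exact Primrec.fst.comp (Primrec.fst.comp Primrec.fst)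

/-- One factor `2 ^ k` of `4 ^ k` is the dyadic denominator; the other turns `2 ^ (k - (e + 1))`
into the weight of program `e`. -/
theorem mixture_div (x n k : ℕ) : (mixture x n k : ℝ) / (4 ^ k : ℕ) =
    ∑ e ∈ Finset.range k, (1 / 2) ^ (e + 1) * ((trim (codeProposal e n) k x : ℝ) / 2 ^ k) := by
  have h4 : ((4 ^ k : ℕ) : ℝ) = 2 ^ k * 2 ^ k := by
    push_cast
    rw [← mul_pow]
    norm_num
  rw [h4, mixture]
  push_cast
  rw [Finset.sum_div]
  refine Finset.sum_congr rfl fun e he => ?_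
  have : (2 : ℝ) ^ k = 2 ^ (k - (e + 1)) * 2 ^ (e + 1) := by
    rw [← pow_add, Nat.sub_add_cancel (Finset.mem_range.1 he)]
  have h2 : (0 : ℝ) < 2 ^ (k - (e + 1)) := by positivity
  have h3 : (0 : ℝ) < 2 ^ (e + 1) := by positivity
  rw [one_div, inv_pow, mul_div_assoc, ← div_div, mul_div_assoc', mul_div_assoc', this]
  field_simp

theorem mixture_mono (x n : ℕ) : Monotone fun k => (mixture x n k : ℝ) / (4 ^ k : ℕ) := by
  intro i j hij
  simp only [mixture_div]
  calc _ ≤ ∑ e ∈ Finset.range i, (1 / 2 : ℝ) ^ (e + 1) *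
        ((trim (codeProposal e n) j x : ℝ) / 2 ^ j) := by
        refine Finset.sum_le_sum fun e _ => mul_le_mul_of_nonneg_left ?_ (by positivity)
        exact monotone_div_two_pow (fun k => two_mul_trim_le _ k x) hij
    _ ≤ _ := Finset.sum_le_sum_of_subset_of_nonneg (Finset.range_subset_range.2 hij)
        fun _ _ _ => by positivity

theorem sum_mixture_le (n k : ℕ) (s : Finset ℕ) :
    ∑ x ∈ s, (mixture x n k : ℝ) / (4 ^ k : ℕ) ≤ 1 := by
  simp only [mixture_div]
  rw [Finset.sum_comm]
  calc _ ≤ ∑ e ∈ Finset.range k, (1 / 2 : ℝ) ^ (e + 1) := by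
        refine Finset.sum_le_sum fun e _ => ?_
        rw [← Finset.mul_sum, ← Finset.sum_div]
        refine mul_le_of_le_one_right (by positivity) ?_
        rw [div_le_one (by positivity)]
        exact_mod_cast sum_trim_le _ k s
    _ ≤ 1 := by
        have : ∑ e ∈ Finset.range k, (1 / 2 : ℝ) ^ (e + 1) = 1 - (1 / 2) ^ k := by
          induction k with
          | zero => simp
          | succ k ih => rw [Finset.sum_range_succ, ih]; ring
        rw [this]
        linarith [pow_pos (show (0 : ℝ) < 1 / 2 by norm_num) k]

theorem exists_tendsto_mixture (x n : ℕ) :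
    ∃ v, Tendsto (fun k => (mixture x n k : ℝ) / (4 ^ k : ℕ)) atTop (𝓝 v) :=
  ⟨_, tendsto_atTop_ciSup (mixture_mono x n) ⟨1, by
    rintro _ ⟨k, rfl⟩
    simpa using sum_mixture_le n k {x}⟩⟩

/-- Conditional a priori probabilities on `ℕ` exist. -/
theorem exists_isCondAPriori_nat : ∃ m : ℕ → ℕ → ℝ, IsCondAPriori m := by
  choose m hm using exists_tendsto_mixture
  refine ⟨m, ⟨fun n => ?_, ?_⟩, fun a ha => ?_⟩
  · refine isSemimeasure_of_sum_le (fun x => ge_of_tendsto' (hm x n) fun k => by positivity)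
      fun s => ?_
    exact le_of_tendsto' (tendsto_finsetSum s fun x _ => hm x n) fun k => sum_mixture_le n k s
  · exact .of_nat_div (p := fun t => mixture t.1.1 t.1.2 t.2) (q := fun t => 4 ^ t.2)
      primrec_mixture.computableIn
      (Primrec.nat_pow.comp (Primrec.const 4) Primrec.snd).computableIn (fun _ => by positivity)
      (fun t => mixture_mono t.1 t.2) (fun t => hm t.1 t.2)
  · obtain ⟨d, hd, hda⟩ := ha.2.exists_dyadicApprox fun t => (ha.1 t.2).1 t.1
    rw [ComputableIn.empty_iff] at hd
    have hd' : Computable fun t : ℕ => d (t.unpair.1.unpair, t.unpair.2) :=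
      hd.comp ((Computable.unpair.comp (Computable.fst.comp Computable.unpair)).pair
        (Computable.snd.comp Computable.unpair))
    obtain ⟨c, hc⟩ := Nat.Partrec.Code.exists_code.1 (Partrec.nat_iff.1 hd')
    -- The reciprocal of the weight of a program `c` computing `d`.
    refine ⟨2 ^ (encode c + 1), by positivity, fun x n => ?_⟩
    have hval : ∀ k y v, v ∈ Nat.Partrec.Code.evaln k c (Nat.pair (Nat.pair y n) k.unpair.1) →
        v = d ((y, n), k.unpair.1) := by
      intro k y v hv
      have := Nat.Partrec.Code.evaln_sound hv
      rw [hc] at this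
      simpa using this
    -- All proposals of `c` lie below the semimeasure `a(·|n)`, so `le_trim` applies to them.
    have hprop : ∀ k y, (codeProposal (encode c) n k y : ℝ) ≤ 2 ^ k * a y n := by
      intro k y
      unfold codeProposal
      rw [Denumerable.ofNat_encode]
      rcases e : Nat.Partrec.Code.evaln k c (Nat.pair (Nat.pair y n) k.unpair.1) with _ | v
      · simpa using (ha.1 n).1 y
      · rw [hval k y v e]
        have h1 := hda.le (y, n) k.unpair.1
        have h2 : (2 : ℝ) ^ k = 2 ^ (k - k.unpair.1) * 2 ^ k.unpair.1 := by
          rw [← pow_add, Nat.sub_add_cancel (Nat.unpair_left_le k)]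
        rw [h2, mul_assoc]
        push_cast
        simp only [Option.getD_some]
        gcongr
    have hmain : ∀ j, (d ((x, n), j) : ℝ) / 2 ^ j ≤ 2 ^ (encode c + 1) * m x n := by
      intro j
      have h0 : d ((x, n), j) ∈ c.eval (Nat.pair (Nat.pair x n) j) := by
        rw [hc]
        simp
      obtain ⟨i, hi⟩ := Nat.Partrec.Code.evaln_complete.1 h0
      -- A stage that treats index `j` and is late enough for `c` to have halted, for `x` to be
      -- admitted and for `c` to enter the mixture.
      set k := Nat.pair j (max i (max x (encode c + 1))) with hk
      have hkj : k.unpair.1 = j := by simp [hk]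
      have hk' : max i (max x (encode c + 1)) ≤ k := Nat.right_le_pair _ _
      have hik : i ≤ k := (le_max_left _ _).trans hk'
      have hxk : x ≤ k := ((le_max_left _ _).trans (le_max_right _ _)).trans hk'
      have hck : encode c < k := ((le_max_right _ _).trans (le_max_right _ _)).trans hk'
      have h1 := Nat.Partrec.Code.evaln_mono hik hi
      have h2 : codeProposal (encode c) n k x = 2 ^ (k - j) * d ((x, n), j) := by
        unfold codeProposal
        rw [Denumerable.ofNat_encode, hkj, h1]
        rfl
      have h3 := le_trim (ha.1 n) (K := k) (fun k' _ y _ => hprop k' y) hxk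
      rw [h2] at h3
      have hjk : j ≤ k := Nat.left_le_pair _ _
      have h4 : (2 : ℝ) ^ k = 2 ^ (k - j) * 2 ^ j := by
        rw [← pow_add, Nat.sub_add_cancel hjk]
      have h5 : (d ((x, n), j) : ℝ) / 2 ^ j ≤ (trim (codeProposal (encode c) n) k x : ℝ) / 2 ^ k := by
        rw [div_le_div_iff₀ (by positivity) (by positivity), h4]
        have : (2 ^ (k - j) * d ((x, n), j) : ℝ) ≤ trim (codeProposal (encode c) n) k x := by
          exact_mod_cast h3
        have h6 : (0 : ℝ) < 2 ^ j := by positivity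
        nlinarith
      have h6 : (1 / 2 : ℝ) ^ (encode c + 1) *
          ((trim (codeProposal (encode c) n) k x : ℝ) / 2 ^ k) ≤ m x n := by
        refine le_trans ?_ ((mixture_mono x n).ge_of_tendsto (hm x n) k)
        rw [mixture_div]
        exact Finset.single_le_sum (f := fun e => (1 / 2 : ℝ) ^ (e + 1) *
          ((trim (codeProposal e n) k x : ℝ) / 2 ^ k)) (fun e _ => by positivity)
          (Finset.mem_range.2 hck)
      refine h5.trans ?_
      rw [one_div, inv_pow] at h6
      rwa [← inv_mul_le_iff₀ (by positivity)]
    exact le_of_tendsto' (hda.tendsto (x, n)) hmain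

end Universal

/-! ### Upper bound by consistent claims -/

section Claims

/-- The number `i` codes the claim that the value at `i.unpair.1` is at least `p / (q + 1)` for all
conditions from `i.unpair.2.unpair.1` on, where `(p, q) = i.unpair.2.unpair.2.unpair`. This is
the claimed lower bound for the value at `x` under the condition `n`, rounded down to a multiple
of `1 / 2 ^ s` and multiplied by `2 ^ s`. -/
def claimValue (i x n s : ℕ) : ℕ :=
  if i.unpair.1 = x ∧ i.unpair.2.unpair.1 ≤ n then
    2 ^ s * i.unpair.2.unpair.2.unpair.1 / (i.unpair.2.unpair.2.unpair.2 + 1)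
  else 0

/-- The best lower bound provided by a list of claims. -/
def claimMax (L : List ℕ) (x n s : ℕ) : ℕ :=
  L.foldr (fun i v => max (claimValue i x n s) v) 0

theorem claimMax_cons (i : ℕ) (L : List ℕ) (x n s : ℕ) :
    claimMax (i :: L) x n s = max (claimValue i x n s) (claimMax L x n s) := rfl

theorem primrec_claimMax :
    Primrec fun t : List ℕ × ℕ × ℕ × ℕ => claimMax t.1 t.2.1 t.2.2.1 t.2.2.2 := by
  have hi : Primrec fun t : (List ℕ × ℕ × ℕ × ℕ) × ℕ × ℕ => t.2.1.unpair :=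
    Primrec.unpair.comp (Primrec.fst.comp Primrec.snd)
  have hi2 : Primrec fun t : (List ℕ × ℕ × ℕ × ℕ) × ℕ × ℕ => t.2.1.unpair.2.unpair :=
    Primrec.unpair.comp (Primrec.snd.comp hi)
  have hi3 : Primrec fun t : (List ℕ × ℕ × ℕ × ℕ) × ℕ × ℕ => t.2.1.unpair.2.unpair.2.unpair :=
    Primrec.unpair.comp (Primrec.snd.comp hi2)
  have hxns : Primrec fun t : (List ℕ × ℕ × ℕ × ℕ) × ℕ × ℕ => t.1.2 :=
    Primrec.snd.comp Primrec.fst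
  have hv : Primrec fun t : (List ℕ × ℕ × ℕ × ℕ) × ℕ × ℕ =>
      claimValue t.2.1 t.1.2.1 t.1.2.2.1 t.1.2.2.2 :=
    Primrec.ite ((Primrec.eq.comp (Primrec.fst.comp hi) (Primrec.fst.comp hxns)).and
      (Primrec.nat_le.comp (Primrec.fst.comp hi2) (Primrec.fst.comp (Primrec.snd.comp hxns))))
      (Primrec.nat_div.comp (Primrec.nat_mul.comp (Primrec.nat_pow.comp (Primrec.const 2)
        (Primrec.snd.comp (Primrec.snd.comp hxns))) (Primrec.fst.comp hi3))
        (Primrec.succ.comp (Primrec.snd.comp hi3))) (Primrec.const 0)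
  exact Primrec.list_foldr (h := fun (t : List ℕ × ℕ × ℕ × ℕ) (p : ℕ × ℕ) =>
      max (claimValue p.1 t.2.1 t.2.2.1 t.2.2.2) p.2)
    Primrec.fst (Primrec.const 0) (Primrec.nat_max.comp hv (Primrec.snd.comp Primrec.snd))

theorem two_mul_claimValue_le (i x n s : ℕ) : 2 * claimValue i x n s ≤ claimValue i x n (s + 1) := by
  unfold claimValue
  split_ifs
  · refine (Nat.le_div_iff_mul_le (Nat.succ_pos _)).2 ?_
    rw [pow_succ, mul_right_comm _ 2, mul_comm _ 2, mul_assoc]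
    exact Nat.mul_le_mul_left 2 (Nat.div_mul_le_self _ _)
  · simp

theorem claimValue_mono (i x s : ℕ) : Monotone fun n => claimValue i x n s := by
  intro n n' h
  simp only [claimValue]
  split_ifs with h1 h2
  · exact le_rfl
  · exact absurd ⟨h1.1, h1.2.trans h⟩ h2
  · exact Nat.zero_le _
  · exact le_rfl

theorem two_mul_claimMax_le (L : List ℕ) (x n s : ℕ) :
    2 * claimMax L x n s ≤ claimMax L x n (s + 1) := by
  induction L with
  | nil => simp [claimMax]
  | cons i L ih =>
    have := two_mul_claimValue_le i x n s
    simp only [claimMax_cons]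
    omega

theorem claimMax_mono (L : List ℕ) (x s : ℕ) : Monotone fun n => claimMax L x n s := by
  intro n n' h
  induction L with
  | nil => exact le_rfl
  | cons i L ih => exact max_le_max (claimValue_mono i x s h) ih

theorem claimValue_le_claimMax {L : List ℕ} {i : ℕ} (h : i ∈ L) (x n s : ℕ) :
    claimValue i x n s ≤ claimMax L x n s := by
  induction L with
  | nil => simp at h
  | cons j L ih =>
    rcases List.mem_cons.1 h with rfl | h
    · exact le_max_left _ _
    · exact (ih h).trans (le_max_right _ _)

/-- The list of natural numbers with a given code. -/
def listOfCode (c : ℕ) : List ℕ :=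
  (decode (α := List ℕ) c).getD []

theorem listOfCode_encode (L : List ℕ) : listOfCode (encode L) = L := by
  simp [listOfCode]

theorem primrec_listOfCode : Primrec listOfCode :=
  Primrec.option_getD.comp Primrec.decode (Primrec.const [])

/-- The approximation `d` raised by the claims in `L`. -/
def raised (d : (ℕ × ℕ) × ℕ → ℕ) (L : List ℕ) (n x s : ℕ) : ℕ :=
  max (d ((x, n), s)) (claimMax L x n s)

/-- The claims in `L` are consistent with `d`: raising `d` accordingly leaves all total masses
bounded by `1`. -/
def Consistent (d : (ℕ × ℕ) × ℕ → ℕ) (L : List ℕ) : Prop :=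
  ∀ n s, ∑ x ∈ Finset.range s, raised d L n x s ≤ 2 ^ s

/-- The oracle `0'` decides consistency of lists of claims. -/
theorem exists_computableIn_consistent {d : (ℕ × ℕ) × ℕ → ℕ} (hd : Computable d) :
    ∃ χ : ℕ → ℕ, ComputableIn {zeroJump} χ ∧
      ∀ c, χ c = 0 ↔ Consistent d (listOfCode c) := by
  have hs : Computable fun t : ℕ × ℕ => t.2.unpair.2 :=
    Computable.snd.comp (Computable.unpair.comp Computable.snd)
  have hL : Computable fun t : (ℕ × ℕ) × ℕ => listOfCode t.1.1 :=
    primrec_listOfCode.to_comp.comp (Computable.fst.comp Computable.fst)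
  have hn : Computable fun t : (ℕ × ℕ) × ℕ => t.1.2.unpair.1 :=
    Computable.fst.comp (Computable.unpair.comp (Computable.snd.comp Computable.fst))
  have hs' : Computable fun t : (ℕ × ℕ) × ℕ => t.1.2.unpair.2 := hs.comp Computable.fst
  have hx : Computable fun t : (ℕ × ℕ) × ℕ => t.2 := Computable.snd
  have hdt : Computable fun t : (ℕ × ℕ) × ℕ => d ((t.2, t.1.2.unpair.1), t.1.2.unpair.2) :=
    hd.comp ((hx.pair hn).pair hs')
  have hct := Computable.comp primrec_claimMax.to_comp (hL.pair (hx.pair (hn.pair hs')))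
  have hraised : Computable₂ fun (t : ℕ × ℕ) (x : ℕ) =>
      raised d (listOfCode t.1) t.2.unpair.1 x t.2.unpair.2 :=
    Primrec.nat_max.to_comp.comp hdt hct
  have hsum := Computable.sum_range hs hraised
  have hlt : Computable fun t : ℕ × ℕ => decide (2 ^ t.1 < t.2) :=
    (Primrec.nat_lt.comp (Primrec.nat_pow.comp (Primrec.const 2) Primrec.fst)
      Primrec.snd).decide.to_comp
  have hp : Computable₂ fun c j : ℕ => decide (2 ^ j.unpair.2 <
      ∑ x ∈ Finset.range j.unpair.2, raised d (listOfCode c) j.unpair.1 x j.unpair.2) := by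
    have := Computable.comp hlt (hs.pair hsum)
    exact this
  obtain ⟨χ, hχ, h⟩ := computableIn_zeroJump_of_exists hp
  refine ⟨χ, hχ, fun c => (h c).trans ⟨fun hc n s => ?_, fun hc j => ?_⟩⟩
  · simpa using hc (Nat.pair n s)
  · simpa using hc j.unpair.1 j.unpair.2

/-- A claim that is true of the limit of `d` can be added to any consistent list. -/
theorem Consistent.cons {d : (ℕ × ℕ) × ℕ → ℕ} {m : ℕ → ℕ → ℝ}
    (hd : IsDyadicApprox d fun t : ℕ × ℕ => m t.1 t.2) {L : List ℕ} (hL : Consistent d L) {i : ℕ}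
    (hi : ∀ x n s, (claimValue i x n s : ℝ) ≤ 2 ^ s * m x n) : Consistent d (i :: L) := by
  intro n s
  -- The raised values converge to a semimeasure `e ≥ m(·|n)`. A true claim lies below `m`, hence
  -- below `e`, and cannot push the mass over 1.
  obtain ⟨e, he, hde⟩ := exists_isSemimeasure_of_double_le (h := raised d L n)
    (fun x k => by
      have h1 := hd.double_le (x, n) k
      have h2 := two_mul_claimMax_le L x n k
      simp only [raised]
      omega) (hL n)
  have hme : ∀ x, m x n ≤ e x := fun x => by
    refine le_of_tendsto_of_tendsto' (hd.tendsto (x, n)) (hde.tendsto x) fun k => ?_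
    gcongr
    exact le_max_left _ _
  have hle : ∀ x, (raised d (i :: L) n x s : ℝ) ≤ 2 ^ s * e x := fun x => by
    have h1 := hde.le x s
    have h2 : (claimValue i x n s : ℝ) ≤ 2 ^ s * e x :=
      (hi x n s).trans (mul_le_mul_of_nonneg_left (hme x) (by positivity))
    have h3 : raised d (i :: L) n x s = max (claimValue i x n s) (raised d L n x s) := by
      simp only [raised, claimMax_cons]
      omega
    rw [h3, Nat.cast_max]
    exact max_le h2 h1
  have : (∑ x ∈ Finset.range s, (raised d (i :: L) n x s : ℝ)) ≤ 2 ^ s := by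
    calc _ ≤ ∑ x ∈ Finset.range s, 2 ^ s * e x := Finset.sum_le_sum fun x _ => hle x
      _ = 2 ^ s * ∑ x ∈ Finset.range s, e x := by rw [Finset.mul_sum]
      _ ≤ 2 ^ s * 1 := by gcongr; exact he.sum_le _
      _ = 2 ^ s := mul_one _
  exact_mod_cast this

/-- The code of the list of those claims below `t` that are accepted when all claims are considered
one after another and `χ` vanishes on the codes of acceptable lists. -/
def acceptedCode (χ : ℕ → ℕ) (t : ℕ) : ℕ :=
  Nat.rec 0 (fun t c => if χ (encode (t :: listOfCode c)) = 0 then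
    encode (t :: listOfCode c) else c) t

/-- The list of accepted claims below `t`. -/
def accepted (χ : ℕ → ℕ) (t : ℕ) : List ℕ :=
  listOfCode (acceptedCode χ t)

theorem accepted_zero (χ : ℕ → ℕ) : accepted χ 0 = [] := by
  rw [accepted, ← listOfCode_encode []]
  rfl

theorem accepted_succ (χ : ℕ → ℕ) (t : ℕ) : accepted χ (t + 1) =
    if χ (encode (t :: accepted χ t)) = 0 then t :: accepted χ t else accepted χ t := by
  have : acceptedCode χ (t + 1) = if χ (encode (t :: accepted χ t)) = 0 then
    encode (t :: accepted χ t) else acceptedCode χ t := rfl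
  rw [accepted, this]
  split_ifs
  · rw [listOfCode_encode]
  · rfl

theorem computableIn_accepted {O : Set (ℕ →. ℕ)} {χ : ℕ → ℕ} (hχ : ComputableIn O χ) :
    ComputableIn O (accepted χ) := by
  have hcons : Primrec fun t : ℕ × ℕ => encode (t.1 :: listOfCode t.2) :=
    Primrec.encode.comp (Primrec.list_cons.comp Primrec.fst
      (primrec_listOfCode.comp Primrec.snd))
  have hite : Primrec fun t : ℕ × ℕ × ℕ => if t.1 = 0 then t.2.1 else t.2.2 :=
    Primrec.ite (Primrec.eq.comp Primrec.fst (Primrec.const 0)) (Primrec.fst.comp Primrec.snd)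
      (Primrec.snd.comp Primrec.snd)
  have hcode : ComputableIn O (acceptedCode χ) := ComputableIn.nat_rec_nat 0
    (f := fun t c => if χ (encode (t :: listOfCode c)) = 0 then
      encode (t :: listOfCode c) else c)
    (hite.computableIn.comp ((hχ.comp hcons.computableIn).pair
      (hcons.computableIn.pair ComputableIn.snd)))
  exact primrec_listOfCode.computableIn.comp hcode

theorem accepted_mono (χ : ℕ → ℕ) {t t' : ℕ} (h : t ≤ t') : accepted χ t ⊆ accepted χ t' := by
  induction h with
  | refl => exact List.Subset.refl _
  | step _ ih =>
    rw [accepted_succ]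
    split_ifs
    · exact List.subset_cons_of_subset _ ih
    · exact ih

theorem consistent_accepted {d : (ℕ × ℕ) × ℕ → ℕ} {χ : ℕ → ℕ}
    (hχ : ∀ c, χ c = 0 ↔ Consistent d (listOfCode c))
    (h0 : Consistent d []) (t : ℕ) : Consistent d (accepted χ t) := by
  induction t with
  | zero => rwa [accepted_zero]
  | succ t ih =>
    rw [accepted_succ]
    split_ifs with h
    · rwa [hχ, listOfCode_encode] at h
    · exact ih

/-- The lower limit of a conditional lower semicomputable semimeasure is bounded by
a `0'`-lower semicomputable semimeasure. -/
theorem exists_liminf_le_nat {m : ℕ → ℕ → ℝ} (hm : IsCondLSCSemimeasure m) :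
    ∃ u : ℕ → ℝ, IsSemimeasure u ∧ LowerSemicomputableIn {zeroJump} u ∧
      ∀ x, liminf (fun n => m x n) atTop ≤ u x := by
  obtain ⟨d, hd, hdm⟩ := hm.2.exists_dyadicApprox fun t => (hm.1 t.2).1 t.1
  rw [ComputableIn.empty_iff] at hd
  obtain ⟨χ, hχ, hχd⟩ := exists_computableIn_consistent hd
  have h0 : Consistent d [] := by
    intro n s
    have : (∑ x ∈ Finset.range s, (raised d [] n x s : ℝ)) ≤ 2 ^ s := by
      calc _ ≤ ∑ x ∈ Finset.range s, 2 ^ s * m x n :=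
            Finset.sum_le_sum fun x _ => by simpa [raised, claimMax] using hdm.le (x, n) s
        _ = 2 ^ s * ∑ x ∈ Finset.range s, m x n := by rw [Finset.mul_sum]
        _ ≤ 2 ^ s * 1 := by gcongr; exact (hm.1 n).sum_le _
        _ = 2 ^ s := mul_one _
    exact_mod_cast this
  have hcons := consistent_accepted hχd h0
  have hmono : ∀ t x n s, claimMax (accepted χ t) x n s ≤ claimMax (accepted χ (t + 1)) x n s := by
    intro t x n s
    rw [accepted_succ]
    split_ifs
    · exact le_max_right _ _
    · exact le_rfl
  -- On the diagonal, `t` bounds the claims considered and serves as condition and as precision.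
  -- Every accepted claim is eventually in force, and consistency at `n = s = t` bounds the mass.
  obtain ⟨u, hu, hdu⟩ := exists_isSemimeasure_of_double_le
    (h := fun x t => claimMax (accepted χ t) x t t)
    (fun x t => (two_mul_claimMax_le _ x t t).trans
      ((claimMax_mono _ x _ t.le_succ).trans (hmono t x _ _)))
    (fun t => (Finset.sum_le_sum fun x _ => le_max_right _ _).trans (hcons t t t))
  refine ⟨u, hu, hdu.lowerSemicomputableIn ?_, fun x => ?_⟩
  · have hargs : ComputableIn {zeroJump} fun t : ℕ × ℕ => (accepted χ t.2, t.1, t.2, t.2) :=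
      ((computableIn_accepted hχ).comp ComputableIn.snd).pair
        (ComputableIn.fst.pair (ComputableIn.snd.pair ComputableIn.snd))
    have := ComputableIn.comp primrec_claimMax.computableIn hargs
    exact this
  · refine le_of_forall_lt fun y hy => ?_
    -- Claims encode non-negative rationals only.
    rcases lt_or_ge y 0 with hy0 | hy0
    · exact hy0.trans_le (hu.1 x)
    obtain ⟨q, hyq, hq⟩ := exists_rat_btwn hy
    refine hyq.trans_le ?_
    have hq0 : 0 ≤ q := by exact_mod_cast hy0.trans hyq.le
    have hbdd : IsBoundedUnder (· ≥ ·) atTop fun n => m x n :=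
      isBoundedUnder_of ⟨0, fun n => (hm.1 n).1 x⟩
    obtain ⟨N, hN⟩ := eventually_atTop.1 (eventually_lt_of_lt_liminf hq hbdd)
    -- Claims store the denominator minus one.
    have hqe : (q : ℝ) = (q.num.toNat : ℝ) / ((q.den - 1 : ℕ) + 1 : ℝ) := by
      have h1 : ((q.den - 1 : ℕ) + 1 : ℝ) = q.den := by
        exact_mod_cast Nat.sub_add_cancel q.pos
      have h2 : (q.num.toNat : ℝ) = q.num := by
        exact_mod_cast Int.toNat_of_nonneg (Rat.num_nonneg.2 hq0)
      rw [h1, h2]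
      exact Rat.cast_def q
    set i := Nat.pair x (Nat.pair N (Nat.pair q.num.toNat (q.den - 1))) with hi
    have hival : ∀ x' n s, claimValue i x' n s =
        if x = x' ∧ N ≤ n then 2 ^ s * q.num.toNat / (q.den - 1 + 1) else 0 := fun x' n s => by
      simp [claimValue, hi]
    have htrue : ∀ x' n s, (claimValue i x' n s : ℝ) ≤ 2 ^ s * m x' n := by
      intro x' n s
      rw [hival]
      split_ifs with h
      · obtain ⟨rfl, hn⟩ := h
        refine Nat.cast_div_le.trans ?_
        push_cast
        rw [mul_div_assoc, ← hqe]
        gcongr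
        exact (hN n hn).le
      · simpa using (hm.1 n).1 x'
    have hmem : i ∈ accepted χ (i + 1) := by
      rw [accepted_succ, if_pos]
      · exact List.mem_cons_self
      · rw [hχd, listOfCode_encode]
        exact (hcons i).cons hdm htrue
    -- The error `(1 / 2) ^ t` comes from rounding the claimed bound down to a multiple of `2 ^ -t`.
    have hlow : ∀ᶠ t : ℕ in atTop, (q : ℝ) - (1 / 2) ^ t ≤ u x := by
      filter_upwards [eventually_ge_atTop (i + 1), eventually_ge_atTop N] with t ht htN
      have h1 : claimValue i x t t ≤ claimMax (accepted χ t) x t t :=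
        claimValue_le_claimMax (accepted_mono χ ht hmem) _ _ _
      rw [hival, if_pos ⟨rfl, htN⟩] at h1
      have h2 := hdu.le x t
      have h3 : (2 : ℝ) ^ t * q ≤ (2 ^ t * q.num.toNat / (q.den - 1 + 1) : ℕ) + 1 := by
        have := (Nat.lt_div_mul_add (a := 2 ^ t * q.num.toNat) (Nat.succ_pos (q.den - 1))).le
        rw [hqe, ← mul_div_assoc, div_le_iff₀ (by positivity)]
        have h4 : 2 ^ t * q.num.toNat ≤
            (2 ^ t * q.num.toNat / (q.den - 1 + 1) + 1) * (q.den - 1 + 1) := by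
          rw [add_mul, one_mul]
          exact this
        exact_mod_cast h4
      have h4 : (2 : ℝ) ^ t * q ≤ 2 ^ t * u x + 1 := by
        have : ((2 ^ t * q.num.toNat / (q.den - 1 + 1) : ℕ) : ℝ) ≤ claimMax (accepted χ t) x t t := by
          exact_mod_cast h1
        simp only at h2
        linarith
      have h5 : (2 : ℝ) ^ t * (1 / 2) ^ t = 1 := by
        rw [← mul_pow]
        norm_num
      refine le_of_mul_le_mul_left ?_ (pow_pos (zero_lt_two (α := ℝ)) t)
      rw [mul_sub, h5]
      linarith
    refine le_of_tendsto ?_ hlow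
    simpa using (tendsto_const_nhds (x := (q : ℝ))).sub (tendsto_pow_atTop_nhds_zero_of_lt_one
      (r := (1 / 2 : ℝ)) (by norm_num) (by norm_num))

end Claims

/-! ### Transfer along the coding by natural numbers -/

section Transfer

variable {α γ : Type*} [Primcodable α] [Primcodable γ] {O : Set (ℕ →. ℕ)}

/-- Extension by zero along the coding preserves lower semicomputability, uniformly in
a parameter. -/
theorem LowerSemicomputableIn.extend_encode {a : α → γ → ℝ}
    (h : LowerSemicomputableIn O fun p : α × γ => a p.1 p.2) :
    LowerSemicomputableIn O fun p : ℕ × γ =>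
      Function.extend (encode : α → ℕ) (fun x => a x p.2) 0 p.1 := by
  classical
  rcases isEmpty_or_nonempty α with hα | ⟨⟨x₀⟩⟩
  · refine .of_nat_div (p := fun _ => 0) (q := fun _ => 1) (ComputableIn.const 0)
      (ComputableIn.const 1) (fun _ => one_ne_zero) (fun _ => ?_) (fun p => ?_)
    · exact fun _ _ _ => le_rfl
    · rw [Function.extend_apply' _ _ _ fun ⟨x, _⟩ => hα.elim x]
      simp
  · have hdec : Primrec fun p : ℕ × γ => ((decode (α := α) p.1).getD x₀, p.2) :=
      (Primrec.option_getD.comp (Primrec.decode.comp Primrec.fst) (Primrec.const x₀)).pair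
        Primrec.snd
    -- This tests whether `p.1` is the code of an element: `encode` sends `none` to 0 and `some x`
    -- to `encode x + 1`, and `decode` may also succeed off the range of `encode`.
    have hP : PrimrecPred fun p : ℕ × γ => encode (decode (α := α) p.1) = p.1 + 1 :=
      Primrec.eq.comp (Primrec.encdec.comp Primrec.fst) (Primrec.succ.comp Primrec.fst)
    convert h.ite_comp hdec.computableIn hP using 2 with p
    split_ifs with hp
    · rcases e : decode (α := α) p.1 with _ | x
      · simp [e] at hp
      · have hx : encode x = p.1 := by simpa [e] using hp
        rw [← hx, encode_injective.extend_apply]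
        simp
    · rw [Function.extend_apply']
      · rfl
      · rintro ⟨x, hx⟩
        exact hp (by rw [← hx, encodek, encode_some])

theorem LowerSemicomputableIn.extend_encode' {a : α → ℝ} (h : LowerSemicomputableIn O a) :
    LowerSemicomputableIn O (Function.extend (encode : α → ℕ) a 0) :=
  (LowerSemicomputableIn.extend_encode (γ := ℕ) (a := fun x _ => a x)
    (h.comp (ComputableIn.fst (β := ℕ)))).comp (ComputableIn.id.pair (ComputableIn.const 0))

theorem IsCondLSCSemimeasure.extend_encode {a : α → ℕ → ℝ} (h : IsCondLSCSemimeasure a) :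
    IsCondLSCSemimeasure fun i n => Function.extend (encode : α → ℕ) (fun x => a x n) 0 i :=
  ⟨fun n => (h.1 n).extend encode_injective, h.2.extend_encode⟩

theorem IsCondLSCSemimeasure.comp_encode {a : ℕ → ℕ → ℝ} (h : IsCondLSCSemimeasure a) :
    IsCondLSCSemimeasure fun (x : α) n => a (encode x) n :=
  ⟨fun n => (h.1 n).comp_injective encode_injective,
    h.2.comp ((Primrec.encode.comp Primrec.fst).pair Primrec.snd).computableIn⟩

end Transfer

/-! ### Existence and the two inequalities -/

section Main

variable {α : Type*} [Primcodable α]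

theorem exists_isCondAPriori : ∃ m : α → ℕ → ℝ, IsCondAPriori m := by
  obtain ⟨m, hm, hmax⟩ := exists_isCondAPriori_nat
  refine ⟨fun x n => m (encode x) n, hm.comp_encode, fun a ha => ?_⟩
  obtain ⟨c, hc, hle⟩ := hmax _ ha.extend_encode
  refine ⟨c, hc, fun x n => ?_⟩
  simpa only [encode_injective.extend_apply] using hle (encode x) n

/-- The lower limit of a conditional lower semicomputable semimeasure is bounded by
a `0'`-lower semicomputable semimeasure. -/
theorem IsCondLSCSemimeasure.exists_liminf_le {m : α → ℕ → ℝ} (hm : IsCondLSCSemimeasure m) :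
    ∃ u : α → ℝ, IsSemimeasure u ∧ LowerSemicomputableIn {zeroJump} u ∧
      ∀ x, liminf (fun n => m x n) atTop ≤ u x := by
  obtain ⟨u, hu, hlsc, hle⟩ := exists_liminf_le_nat hm.extend_encode
  refine ⟨fun x => u (encode x), hu.comp_injective encode_injective,
    hlsc.comp Primrec.encode.computableIn, fun x => ?_⟩
  simpa only [encode_injective.extend_apply] using hle (encode x)

/-- A conditional a priori probability has a lower limit that dominates every `0'`-lower
semicomputable semimeasure. -/
theorem IsCondAPriori.exists_le_liminf {m : α → ℕ → ℝ} (hm : IsCondAPriori m) {a : α → ℝ}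
    (ha : IsSemimeasure a) (hlsc : LowerSemicomputableIn {zeroJump} a) :
    ∃ c : ℝ, 0 < c ∧ ∀ x, a x ≤ c * liminf (fun n => m x n) atTop := by
  obtain ⟨b, hb, hle⟩ := exists_le_liminf_nat (ha.extend encode_injective) hlsc.extend_encode'
  obtain ⟨c, hc, hbm⟩ := hm.2 _ (hb.comp_encode (α := α))
  refine ⟨c, hc, fun x => ?_⟩
  have h1 := hle (encode x)
  rw [encode_injective.extend_apply] at h1
  rw [← div_le_iff₀' hc]
  -- The strict gap lets a bound on the lower limit of `b` pass to eventually all `n`.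
  refine le_of_forall_lt fun y hy => ?_
  obtain ⟨z, hyz, hz⟩ := exists_between hy
  refine hyz.trans_le ?_
  rw [lt_div_iff₀' hc] at hz
  refine le_liminf_of_le (isCoboundedUnder_ge_of_le atTop (x := 1)
    fun n => (hm.1.1 n).le_one x) ?_
  have hbdd : IsBoundedUnder (· ≥ ·) atTop fun n => b (encode x) n :=
    isBoundedUnder_of ⟨0, fun n => (hb.1 n).1 _⟩
  filter_upwards [eventually_lt_of_lt_liminf (hz.trans_le h1) hbdd] with n hn
  exact le_of_mul_le_mul_left (hn.le.trans (hbm x n)) hc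

/-- No enumeration of oracle programs is needed: the upper bound `u` for the lower limit of a
universal `m` dominates that limit, which already dominates every competitor. -/
theorem exists_isAPrioriIn_zeroJump : ∃ m' : α → ℝ, IsAPrioriIn {zeroJump} m' := by
  obtain ⟨m, hm⟩ := exists_isCondAPriori (α := α)
  obtain ⟨u, hu, hlsc, hle⟩ := hm.1.exists_liminf_le
  refine ⟨u, ⟨hu, hlsc⟩, fun a ha halsc => ?_⟩
  obtain ⟨c, hc, hac⟩ := hm.exists_le_liminf ha halsc
  exact ⟨c, hc, fun x => (hac x).trans (mul_le_mul_of_nonneg_left (hle x) hc.le)⟩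

end Main

end APriori

theorem theorem2 {α : Type*} [Primcodable α] :
    (∃ m : α → ℕ → ℝ, APriori.IsCondAPriori m) ∧
    (∃ m' : α → ℝ, APriori.IsAPrioriIn {APriori.zeroJump} m') ∧
    ∀ (m : α → ℕ → ℝ) (m' : α → ℝ),
      APriori.IsCondAPriori m → APriori.IsAPrioriIn {APriori.zeroJump} m' →
      ∃ c C : ℝ, 0 < c ∧ 0 < C ∧ ∀ x : α,
        c * m' x ≤ Filter.liminf (fun n => m x n) Filter.atTop ∧
        Filter.liminf (fun n => m x n) Filter.atTop ≤ C * m' x := by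
  refine ⟨APriori.exists_isCondAPriori, APriori.exists_isAPrioriIn_zeroJump,
    fun m m' hm hm' => ?_⟩
  obtain ⟨c, hc, hle⟩ := hm.exists_le_liminf hm'.1.1 hm'.1.2
  obtain ⟨u, hu, hlsc, hmu⟩ := hm.1.exists_liminf_le
  obtain ⟨C, hC, huC⟩ := hm'.2 u hu hlsc
  exact ⟨c⁻¹, C, inv_pos.2 hc, hC, fun x =>
    ⟨(inv_mul_le_iff₀ hc).2 (hle x), (hmu x).trans (huC x)⟩⟩
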